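/- Let $n\ge 1$, $s\in(0,1)$ with $n>2s$, $\lambda>0$, and put $2^*_s=\frac{2n}{n-2s}$. There is a function $(q,t)\mapsto M(q,t)\in[0,\infty)$, depending only on $n,s,\lambda$, with the following property. Let $K:\mathbb R^n\setminus\{0\}\to(0,\infty)$ be measurable with $K(-x)=K(x)$, $K(x)|x|^{n+2s}\ge\lambda$ for almost every $x$, and $\min\{|x|^2,1\}K\in L^1(\mathbb R^n)$. Let $V:\mathbb R^n\to\mathbb R$ be continuous with $\inf V>0$. Let $X$ be the space of $u\in L^2(\mathbb R^n)$ such that $(x,y)\mapsto (u(x)-u(y))\sqrt{K(x-y)}$ is in $L^2(\mathbb R^n\times\mathbb R^n)$, and $E=\{u\in X:\int_{\mathbb R^n} V u^2\,dx<\infty\}$. Let $b:\mathbb R^n\to[0,\infty)$, let $h\in L^q(\mathbb R^n)$ with $\frac{n}{2s}<q\le\infty$, and let $g:\mathbb R^n\times\mathbb R\to\mathbb R$ satisfy $|g(x,t)|\le h(x)|t|$ for almost every $x\in\mathbb R^n$ and all $t\in\mathbb R$. Let $v\in E$ be a weak solution of $$-\mathcal L_K v+b(x)v=g(x,v)\quad\text{in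 }\mathbb R^n,$$ that is, for every $\varphi\in E$ the functions $b\,v\,\varphi$ and $g(\cdot,v)\varphi$ are integrable and $$\int_{\mathbb R^n}\!\int_{\mathbb R^n}(v(x)-v(y))(\varphi(x)-\varphi(y))K(x-y)\,dx\,dy+\int_{\mathbb R^n}b\,v\,\varphi\,dx=\int_{\mathbb R^n}g(x,v)\,\varphi\,dx .$$ Then $v\in L^\infty(\mathbb R^n)$ and $$\|v\|_{\infty}\le M\big(q,\|h\|_{L^q}\big)\,\|v\|_{2^*_s}.$$ -/

import Mathlib

open MeasureTheory
open scoped ENNReal NNReal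

namespace NonlocalSchrodinger

/-- The standing hypotheses on the kernel `K : ℝⁿ → (0, ∞)` (its value at the origin is
irrelevant): `K` is Lebesgue measurable, even, bounded below by `lam |x| ^ (-(n + 2 s))` almost
everywhere, and `min (|x|², 1) K` is integrable. -/
structure IsKernel (n : ℕ) (s lam : ℝ) (K : EuclideanSpace ℝ (Fin n) → ℝ) : Prop where
  aemeasurable : AEMeasurable K volume
  pos : ∀ x, x ≠ 0 → 0 < K x
  even : ∀ x, K (-x) = K x
  lower_bound : ∀ᵐ x ∂volume, lam ≤ K x * ‖x‖ ^ ((n : ℝ) + 2 * s)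
  integrable : Integrable (fun x => min (‖x‖ ^ 2) 1 * K x) volume

/-- The standing hypotheses on the potential `V`: continuous, with positive infimum. -/
structure IsPotential (n : ℕ) (V : EuclideanSpace ℝ (Fin n) → ℝ) : Prop where
  continuous : Continuous V
  lower_bound : ∃ c : ℝ, 0 < c ∧ ∀ x, c ≤ V x

/-- Membership in `X`: `u ∈ L²(ℝⁿ)` and `(x, y) ↦ (u x - u y) √K(x - y)` is in `L²(ℝⁿ × ℝⁿ)`. -/
def MemX {n : ℕ} (K : EuclideanSpace ℝ (Fin n) → ℝ) (u : EuclideanSpace ℝ (Fin n) → ℝ) : Prop :=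
  MemLp u 2 volume ∧
    MemLp (fun p : EuclideanSpace ℝ (Fin n) × EuclideanSpace ℝ (Fin n) =>
      (u p.1 - u p.2) * Real.sqrt (K (p.1 - p.2))) 2 (volume.prod volume)

/-- Membership in `E`: `u ∈ X` and `∫ V u² < ∞`. -/
def MemE {n : ℕ} (K V : EuclideanSpace ℝ (Fin n) → ℝ) (u : EuclideanSpace ℝ (Fin n) → ℝ) : Prop :=
  MemX K u ∧ Integrable (fun x => V x * u x ^ 2) volume

/-- The bilinear form `[u, φ] = ∬ (u x - u y) (φ x - φ y) K(x - y) dx dy` of `-L_K`, where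
`-L_K u (x) = 2 ∫ (u x - u y) K(x - y) dy`. The integrand is integrable for `u, φ` in `X`. -/
noncomputable def form {n : ℕ} (K : EuclideanSpace ℝ (Fin n) → ℝ)
    (u φ : EuclideanSpace ℝ (Fin n) → ℝ) : ℝ :=
  ∫ p : EuclideanSpace ℝ (Fin n) × EuclideanSpace ℝ (Fin n),
    (u p.1 - u p.2) * (φ p.1 - φ p.2) * K (p.1 - p.2) ∂(volume.prod volume)

/-- `v ∈ E` is a weak solution of `-L_K v + b(x) v = g(x, v)` in `ℝⁿ`, tested against all
`φ ∈ E`; the integrals in the weak formulation are required to make sense. -/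
def IsWeakSolution {n : ℕ} (K V b : EuclideanSpace ℝ (Fin n) → ℝ)
    (g : EuclideanSpace ℝ (Fin n) → ℝ → ℝ) (v : EuclideanSpace ℝ (Fin n) → ℝ) : Prop :=
  MemE K V v ∧
    ∀ φ : EuclideanSpace ℝ (Fin n) → ℝ, MemE K V φ →
      Integrable (fun x => b x * v x * φ x) volume ∧
      Integrable (fun x => g x (v x) * φ x) volume ∧
      form K v φ + ∫ x, b x * v x * φ x = ∫ x, g x (v x) * φ x

/-- The critical exponent `2n / (n - 2s)`, used for `2s < n`. -/
noncomputable def critExp (n : ℕ) (s : ℝ) : ℝ := 2 * (n : ℝ) / ((n : ℝ) - 2 * s)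

end NonlocalSchrodinger

namespace NonlocalSchrodinger

/-! De Giorgi iteration, with `p` the critical exponent. Test the equation with the part of `v`
above height `d`, `S_d v = softThreshold d v`. Monotonicity and the Lipschitz bound for `S_d` make
the form at least the energy of `S_d v`, and the `b`-term is nonnegative, so
`energy_softThreshold_le` bounds this energy by `∫ |h| |v| |S_d v|`. For `c < d` the product `|v|
|S_d v|` is at most a constant times `|S_c v| ^ (2 + θ)`. Hölder with `h ∈ L^q` returns the `L^p`
norm of `S_c v` precisely when `θ = p (1 - 1/q) - 2`, which is positive because `q > n / (2 s)`.
With the Sobolev inequality `sobolev`, the squared norm at level `d` is bounded by the norm at level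
`c` to a power larger than 2.

Along the levels `A (1 - 2 ^ (-k))` this forces geometric decay once `‖v‖_p ≤ A δ`
(`exists_geometric_decay`), whence `|v| ≤ A` almost everywhere. The recursion is homogeneous in `A`,
so `δ` depends only on `q` and `‖h‖_q` besides `n`, `s`, `lam`, and the bound is linear with `M = 1
/ δ`.

The Sobolev inequality is proved directly from the lower bound on `K`, by comparing `u x` with its
values on a ball around `x`. -/

/-! ### Arithmetic of the critical exponent -/

lemma critExp_pos {n : ℕ} {s : ℝ} (hs0 : 0 < s) (hn : 2 * s < (n : ℝ)) : 0 < critExp n s := by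
  unfold critExp
  exact div_pos (by linarith) (by linarith)

lemma two_lt_critExp {n : ℕ} {s : ℝ} (hs0 : 0 < s) (hn : 2 * s < (n : ℝ)) : 2 < critExp n s := by
  unfold critExp
  rw [lt_div_iff₀ (by linarith)]
  linarith

lemma two_div_critExp {n : ℕ} {s : ℝ} (hs0 : 0 < s) (hn : 2 * s < (n : ℝ)) :
    2 / critExp n s = 1 - 2 * s / n := by
  unfold critExp
  have h1 : (n : ℝ) ≠ 0 := by linarith
  have h2 : (n : ℝ) - 2 * s ≠ 0 := by linarith
  field_simp

lemma critExp_balance {n : ℕ} {s : ℝ} (hs0 : 0 < s) (hn : 2 * s < (n : ℝ)) :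
    2 + critExp n s * (2 * s / n) = critExp n s := by
  have h := two_div_critExp hs0 hn
  have hp := critExp_pos hs0 hn
  have : critExp n s * (2 / critExp n s) = 2 := by field_simp
  rw [h] at this
  linarith

/-! ### Fractional Sobolev inequality for functions already in `L^p` -/

/-- The volume of the unit ball of `ℝⁿ`. -/
noncomputable def ballVolume (n : ℕ) : ℝ :=
  (volume (Metric.ball (0 : EuclideanSpace ℝ (Fin n)) 1)).toReal

lemma ballVolume_pos (n : ℕ) : 0 < ballVolume n :=
  ENNReal.toReal_pos (Metric.measure_ball_pos volume _ one_pos).ne' measure_ball_lt_top.ne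

lemma volume_ball_eq {n : ℕ} (x : EuclideanSpace ℝ (Fin n)) {r : ℝ} (hr : 0 < r) :
    volume (Metric.ball x r) = ENNReal.ofReal (r ^ n * ballVolume n) := by
  rw [Measure.addHaar_ball_of_pos volume x hr, finrank_euclideanSpace, Fintype.card_fin,
    ENNReal.ofReal_mul (by positivity), ballVolume, ENNReal.ofReal_toReal measure_ball_lt_top.ne]

/-- A constant for the fractional Sobolev inequality with kernel bounded below by
`lam |x| ^ (-(n + 2 s))`. -/
noncomputable def sobolevConst (n : ℕ) (s lam : ℝ) : ℝ :=
  8 / (lam * ballVolume n) * (2 ^ (critExp n s + 1) / ballVolume n) ^ (2 * s / n)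

lemma sobolevConst_pos (n : ℕ) (s : ℝ) {lam : ℝ} (hlam : 0 < lam) : 0 < sobolevConst n s lam := by
  have := ballVolume_pos n
  unfold sobolevConst
  positivity

/-- The quadratic form of the kernel `K`, with values in `[0, ∞]`. -/
noncomputable def energy {n : ℕ} (K u : EuclideanSpace ℝ (Fin n) → ℝ) : ℝ≥0∞ :=
  ∫⁻ p : EuclideanSpace ℝ (Fin n) × EuclideanSpace ℝ (Fin n),
    ENNReal.ofReal ((u p.1 - u p.2) ^ 2 * K (p.1 - p.2)) ∂(volume.prod volume)

/-- The powers of `t` agree by `critExp_balance`; the remaining factors dictate the value of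
`sobolevConst`. -/
lemma sobolev_scaling {n : ℕ} {s lam : ℝ} (hs0 : 0 < s) (hn : 2 * s < (n : ℝ)) (hlam : 0 < lam)
    {t I : ℝ} (ht : 0 < t) (hI : 0 < I) :
    let m := 2 ^ critExp n s * I / t ^ critExp n s
    let r := (2 * m / ballVolume n) ^ (1 / (n : ℝ))
    t ^ critExp n s = sobolevConst n s lam * I ^ (2 * s / n) *
      ((t / 2) ^ 2 * (lam / r ^ ((n : ℝ) + 2 * s)) * m) := by
  intro m r
  have hω := ballVolume_pos n
  have hm : 0 < m := by positivity
  have hn0 : (n : ℝ) ≠ 0 := by linarith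
  set w := 2 * m / ballVolume n with hw
  have hw0 : 0 < w := by positivity
  have hr : r ^ ((n : ℝ) + 2 * s) = w * w ^ (2 * s / n) := by
    rw [← Real.rpow_mul hw0.le, show 1 / (n : ℝ) * (n + 2 * s) = 1 + 2 * s / n by field_simp,
      Real.rpow_add hw0, Real.rpow_one]
  have hw2 : w = (2 ^ (critExp n s + 1) / ballVolume n) * I / t ^ critExp n s := by
    rw [hw, Real.rpow_add two_pos, Real.rpow_one]
    simp only [m]
    ring
  have hws : w ^ (2 * s / n) = (2 ^ (critExp n s + 1) / ballVolume n) ^ (2 * s / n) *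
      I ^ (2 * s / n) / t ^ (critExp n s * (2 * s / n)) := by
    rw [hw2, Real.div_rpow (by positivity) (by positivity), Real.mul_rpow (by positivity) hI.le,
      Real.rpow_mul ht.le]
  have hmw : m = w * ballVolume n / 2 := by rw [hw]; field_simp
  have hsplit : t ^ critExp n s = t ^ 2 * t ^ (critExp n s * (2 * s / n)) := by
    conv_lhs => rw [← critExp_balance hs0 hn, Real.rpow_add ht]
    norm_num
  rw [hr, hws, hmw, hsplit, sobolevConst]
  have h1 : 0 < (2 ^ (critExp n s + 1) / ballVolume n) ^ (2 * s / n) := by positivity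
  have h2 : 0 < I ^ (2 * s / n) := by positivity
  have h3 : 0 < t ^ (critExp n s * (2 * s / n)) := by positivity
  generalize (2 ^ (critExp n s + 1) / ballVolume n) ^ (2 * s / n) = a at *
  generalize I ^ (2 * s / n) = b at *
  generalize t ^ (critExp n s * (2 * s / n)) = c at *
  clear_value w
  field_simp
  norm_num

variable {n : ℕ} {s lam : ℝ} {K : EuclideanSpace ℝ (Fin n) → ℝ}

/-- By Chebyshev, `|u| ≥ |u x| / 2` only on a set of measure at most `m`. In a ball around `x` of
volume `2 m`, at least measure `m` is left where `|u x - u y| ≥ |u x| / 2`, and there `K (x - y)` is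
at least `lam / r ^ (n + 2 s)`. -/
lemma rpow_abs_le_mul_lintegral (hs0 : 0 < s) (hn : 2 * s < (n : ℝ)) (hlam : 0 < lam)
    (hK : IsKernel n s lam K) {u : EuclideanSpace ℝ (Fin n) → ℝ}
    (hu : AEStronglyMeasurable u volume) {I : ℝ} (hI0 : 0 < I)
    (hI : ∫⁻ x, ENNReal.ofReal (|u x| ^ critExp n s) ≤ ENNReal.ofReal I)
    (x : EuclideanSpace ℝ (Fin n)) :
    ENNReal.ofReal (|u x| ^ critExp n s) ≤
      ENNReal.ofReal (sobolevConst n s lam * I ^ (2 * s / n)) *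
        ∫⁻ y, ENNReal.ofReal ((u x - u y) ^ 2 * K (x - y)) := by
  have hp := critExp_pos hs0 hn
  have hω := ballVolume_pos n
  have hn0 : (n : ℝ) ≠ 0 := by linarith
  rcases (abs_nonneg (u x)).eq_or_lt with h0 | ht
  · rw [← h0, Real.zero_rpow hp.ne']
    simp
  have hscale := sobolev_scaling hs0 hn hlam ht hI0
  set t := |u x| with htdef
  set m := 2 ^ critExp n s * I / t ^ critExp n s with hmdef
  have hm : 0 < m := by positivity
  set r := (2 * m / ballVolume n) ^ (1 / (n : ℝ)) with hrdef
  have hr : 0 < r := by positivity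
  let A : Set (EuclideanSpace ℝ (Fin n)) := {y | t / 2 ≤ |u y|}
  have hAm : NullMeasurableSet A volume :=
    nullMeasurableSet_le aemeasurable_const hu.norm.aemeasurable
  have hA : volume A ≤ ENNReal.ofReal m := by
    have h1 := mul_meas_ge_le_lintegral₀ (μ := (volume : Measure (EuclideanSpace ℝ (Fin n))))
      (f := fun y => ENNReal.ofReal (|u y| ^ critExp n s))
      ((hu.norm.aemeasurable.pow_const _).ennreal_ofReal)
      (ENNReal.ofReal ((t / 2) ^ critExp n s))
    have h2 : volume A ≤ volume {y | ENNReal.ofReal ((t / 2) ^ critExp n s) ≤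
        ENNReal.ofReal (|u y| ^ critExp n s)} := by
      refine measure_mono fun y hy => ?_
      exact ENNReal.ofReal_le_ofReal (Real.rpow_le_rpow (by positivity) hy hp.le)
    have h3 : ENNReal.ofReal ((t / 2) ^ critExp n s) * volume A ≤
        ENNReal.ofReal ((t / 2) ^ critExp n s) * ENNReal.ofReal m := by
      refine (mul_le_mul_right h2 _).trans (h1.trans (hI.trans_eq ?_))
      rw [← ENNReal.ofReal_mul (by positivity), hmdef, Real.div_rpow ht.le two_pos.le]
      congr 1
      field_simp
    exact (ENNReal.mul_le_mul_iff_right (by simp; positivity) ENNReal.ofReal_ne_top).1 h3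
  have hball : volume (Metric.ball x r) = ENNReal.ofReal (2 * m) := by
    rw [volume_ball_eq x hr, hrdef, ← Real.rpow_natCast, ← Real.rpow_mul (by positivity)]
    congr 1
    rw [one_div_mul_cancel hn0, Real.rpow_one]
    field_simp
  set T := Metric.ball x r \ A
  have hT : ENNReal.ofReal m ≤ volume T := by
    refine le_trans ?_ le_measure_sdiff
    rw [hball]
    refine le_trans ?_ (tsub_le_tsub_left hA _)
    rw [← ENNReal.ofReal_sub _ hm.le]
    exact ENNReal.ofReal_le_ofReal (by linarith)
  have hTm : NullMeasurableSet T volume := measurableSet_ball.nullMeasurableSet.diff hAm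
  have hKx : ∀ᵐ y ∂(volume : Measure (EuclideanSpace ℝ (Fin n))),
      lam ≤ K (x - y) * ‖x - y‖ ^ ((n : ℝ) + 2 * s) :=
    (quasiMeasurePreserving_sub_left volume x).ae hK.lower_bound
  have hD : ENNReal.ofReal ((t / 2) ^ 2 * (lam / r ^ ((n : ℝ) + 2 * s))) * ENNReal.ofReal m ≤
      ∫⁻ y, ENNReal.ofReal ((u x - u y) ^ 2 * K (x - y)) := by
    refine (mul_le_mul_right hT _).trans ?_
    rw [← setLIntegral_const]
    refine le_trans (lintegral_mono_ae ?_) (setLIntegral_le_lintegral T _)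
    rw [ae_restrict_iff'₀ hTm]
    filter_upwards [hKx] with y hy hyT
    refine ENNReal.ofReal_le_ofReal ?_
    have hyr : ‖x - y‖ ≤ r := by
      have := hyT.1
      rw [Metric.mem_ball, dist_comm, dist_eq_norm] at this
      exact this.le
    have hyA : |u y| < t / 2 := not_le.1 hyT.2
    have hK0 : 0 < K (x - y) :=
      pos_of_mul_pos_left (hlam.trans_le hy) (by positivity)
    have hKr : lam / r ^ ((n : ℝ) + 2 * s) ≤ K (x - y) := by
      rw [div_le_iff₀ (by positivity)]
      refine hy.trans (mul_le_mul_of_nonneg_left ?_ hK0.le)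
      exact Real.rpow_le_rpow (norm_nonneg _) hyr (by linarith)
    have hdiff : t / 2 ≤ |u x - u y| := by
      have := abs_sub_abs_le_abs_sub (u x) (u y)
      linarith
    have hsq : (t / 2) ^ 2 ≤ (u x - u y) ^ 2 := by
      rw [← sq_abs (u x - u y)]
      exact pow_le_pow_left₀ (by positivity) hdiff 2
    exact mul_le_mul hsq hKr (by positivity) (by positivity)
  rw [hscale, ENNReal.ofReal_mul (by have := sobolevConst_pos n s hlam; positivity)]
  refine mul_le_mul_right ?_ _
  rwa [ENNReal.ofReal_mul (by positivity)]

lemma aemeasurable_energy_integrand (hK : IsKernel n s lam K)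
    {u : EuclideanSpace ℝ (Fin n) → ℝ} (hu : AEStronglyMeasurable u volume) :
    AEMeasurable (fun p : EuclideanSpace ℝ (Fin n) × EuclideanSpace ℝ (Fin n) =>
      ENNReal.ofReal ((u p.1 - u p.2) ^ 2 * K (p.1 - p.2))) (volume.prod volume) := by
  have h1 : AEMeasurable (fun p : EuclideanSpace ℝ (Fin n) × EuclideanSpace ℝ (Fin n) =>
      K (p.1 - p.2)) (volume.prod volume) :=
    hK.aemeasurable.comp_quasiMeasurePreserving (quasiMeasurePreserving_sub volume volume)
  have h2 : AEMeasurable (fun p : EuclideanSpace ℝ (Fin n) × EuclideanSpace ℝ (Fin n) =>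
      u p.1 - u p.2) (volume.prod volume) :=
    hu.comp_fst.aemeasurable.sub hu.comp_snd.aemeasurable
  exact ((h2.pow_const 2).mul h1).ennreal_ofReal

lemma eLpNorm_critExp_eq (hs0 : 0 < s) (hn : 2 * s < (n : ℝ))
    (u : EuclideanSpace ℝ (Fin n) → ℝ) :
    eLpNorm u (ENNReal.ofReal (critExp n s)) volume =
      (∫⁻ x, ENNReal.ofReal (|u x| ^ critExp n s)) ^ (1 / critExp n s) := by
  have hp := critExp_pos hs0 hn
  rw [eLpNorm_eq_lintegral_rpow_enorm_toReal (by simpa using hp) ENNReal.ofReal_ne_top,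
    ENNReal.toReal_ofReal hp.le]
  congr 1
  refine lintegral_congr fun x => ?_
  rw [Real.enorm_eq_ofReal_abs, ENNReal.ofReal_rpow_of_nonneg (abs_nonneg _) hp.le]

lemma sobolev_of_memLp (hs0 : 0 < s) (hn : 2 * s < (n : ℝ)) (hlam : 0 < lam)
    (hK : IsKernel n s lam K) {u : EuclideanSpace ℝ (Fin n) → ℝ}
    (hu : MemLp u (ENNReal.ofReal (critExp n s)) volume) :
    eLpNorm u (ENNReal.ofReal (critExp n s)) volume ^ 2 ≤
      ENNReal.ofReal (sobolevConst n s lam) * energy K u := by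
  have hp := critExp_pos hs0 hn
  have hfin := hu.2
  have hC := sobolevConst_pos n s hlam
  rw [eLpNorm_critExp_eq hs0 hn] at hfin ⊢
  set J := ∫⁻ x, ENNReal.ofReal (|u x| ^ critExp n s) with hJ
  have hJfin : J ≠ ∞ := by
    intro h
    rw [h, ENNReal.top_rpow_of_pos (by positivity)] at hfin
    exact lt_irrefl _ hfin
  rcases eq_or_ne J 0 with h0 | h0
  · rw [h0, ENNReal.zero_rpow_of_pos (by positivity)]
    simp
  have hI0 : 0 < J.toReal := ENNReal.toReal_pos h0 hJfin
  have hIJ : ENNReal.ofReal J.toReal = J := ENNReal.ofReal_toReal hJfin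
  have hint : J ≤ ENNReal.ofReal (sobolevConst n s lam * J.toReal ^ (2 * s / n)) * energy K u := by
    rw [energy, lintegral_prod _ (aemeasurable_energy_integrand hK hu.1),
      ← lintegral_const_mul' _ _ ENNReal.ofReal_ne_top]
    exact lintegral_mono fun x =>
      rpow_abs_le_mul_lintegral hs0 hn hlam hK hu.1 hI0 (hJ.symm.le.trans hIJ.symm.le) x
  rw [← ENNReal.rpow_natCast, ← ENNReal.rpow_mul]
  have hexp : 1 / critExp n s * (2 : ℕ) = 1 - 2 * s / n := by
    rw [← two_div_critExp hs0 hn]; push_cast; ring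
  rw [hexp]
  rw [ENNReal.ofReal_mul hC.le, ← ENNReal.ofReal_rpow_of_pos hI0, hIJ] at hint
  -- Integrating the pointwise bound gave `J ≤ C J ^ (2 s / n) * energy`. Cancelling the power of
  -- `J` requires `J` finite, hence the `L^p` hypothesis.
  have hpow0 : J ^ (2 * s / n) ≠ 0 := by simp [ENNReal.rpow_eq_zero_iff, h0, hJfin]
  have hpowtop : J ^ (2 * s / n) ≠ ∞ := by simp [ENNReal.rpow_eq_top_iff, h0, hJfin]
  refine (ENNReal.mul_le_mul_iff_right hpow0 hpowtop).1 ?_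
  rw [← ENNReal.rpow_add _ _ h0 hJfin, add_sub_cancel, ENNReal.rpow_one]
  exact hint.trans_eq (by ring)

/-! ### Truncation, and the Sobolev inequality on `L²` -/

/-- Truncation of `t` to the interval `[-c, c]`. -/
noncomputable def clip (c t : ℝ) : ℝ := max (-c) (min t c)

lemma continuous_clip (c : ℝ) : Continuous (clip c) := by unfold clip; fun_prop

lemma abs_clip_sub_clip_le (c a b : ℝ) : |clip c a - clip c b| ≤ |a - b| := by
  unfold clip
  rcases le_total a b with h | h <;> grind

lemma abs_clip_le_abs {c : ℝ} (hc : 0 ≤ c) (t : ℝ) : |clip c t| ≤ |t| := by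
  unfold clip; grind

lemma abs_clip_le {c : ℝ} (hc : 0 ≤ c) (t : ℝ) : |clip c t| ≤ c := by
  unfold clip; grind

lemma clip_of_abs_le {c t : ℝ} (h : |t| ≤ c) : clip c t = t := by
  unfold clip; grind

lemma energy_mono_of_abs_sub_le (hK : IsKernel n s lam K) {u w : EuclideanSpace ℝ (Fin n) → ℝ}
    (h : ∀ x y, |u x - u y| ≤ |w x - w y|) : energy K u ≤ energy K w := by
  refine lintegral_mono fun p => ENNReal.ofReal_le_ofReal ?_
  rcases eq_or_ne p.1 p.2 with hp | hp
  · simp [hp]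
  · exact mul_le_mul_of_nonneg_right (sq_le_sq.2 (h _ _)) (hK.pos _ (sub_ne_zero.2 hp)).le

/-- **Fractional Sobolev inequality** for the form of `K`, on `L²`. -/
lemma sobolev (hs0 : 0 < s) (hn : 2 * s < (n : ℝ)) (hlam : 0 < lam)
    (hK : IsKernel n s lam K) {u : EuclideanSpace ℝ (Fin n) → ℝ} (hu : MemLp u 2 volume) :
    eLpNorm u (ENNReal.ofReal (critExp n s)) volume ^ 2 ≤
      ENNReal.ofReal (sobolevConst n s lam) * energy K u := by
  have hmeas : ∀ k : ℕ, AEStronglyMeasurable (fun x => clip k (u x)) volume := fun k =>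
    (continuous_clip k).comp_aestronglyMeasurable hu.1
  have hmem : ∀ k : ℕ, MemLp (fun x => clip k (u x)) (ENNReal.ofReal (critExp n s)) volume := by
    intro k
    have h2 : MemLp (fun x => clip k (u x)) 2 volume :=
      hu.mono (hmeas k) (ae_of_all _ fun x => abs_clip_le_abs k.cast_nonneg _)
    -- A bounded `L²` function is in `L^p`, since `p > 2`.
    have hint : ∫⁻ x, ENNReal.ofReal (|clip k (u x)| ^ critExp n s) ≤
        ENNReal.ofReal ((k : ℝ) ^ (critExp n s - 2)) *
          ∫⁻ x, ENNReal.ofReal (clip k (u x) ^ 2) := by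
      rw [← lintegral_const_mul' _ _ ENNReal.ofReal_ne_top]
      refine lintegral_mono fun x => ?_
      rw [← ENNReal.ofReal_mul (by positivity), ← sq_abs]
      refine ENNReal.ofReal_le_ofReal ?_
      have hle := abs_clip_le (Nat.cast_nonneg (α := ℝ) k) (u x)
      have hp2 := two_lt_critExp hs0 hn
      have hsplit : |clip k (u x)| ^ critExp n s =
          |clip k (u x)| ^ (critExp n s - 2) * |clip k (u x)| ^ 2 := by
        rw [← Real.rpow_natCast _ 2, ← Real.rpow_add_of_nonneg (abs_nonneg _) (by linarith)
          (by norm_num)]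
        norm_num
      rw [hsplit]
      exact mul_le_mul_of_nonneg_right
        (Real.rpow_le_rpow (abs_nonneg _) hle (by linarith)) (sq_nonneg _)
    refine ⟨hmeas k, ?_⟩
    rw [eLpNorm_critExp_eq hs0 hn]
    refine ENNReal.rpow_lt_top_of_nonneg (by have := critExp_pos hs0 hn; positivity) ?_
    exact (hint.trans_lt (ENNReal.mul_lt_top ENNReal.ofReal_lt_top
      h2.integrable_sq.lintegral_lt_top)).ne
  -- Fatou: truncation does not increase the energy, so the bound is uniform in `k`.
  have hlim : eLpNorm u (ENNReal.ofReal (critExp n s)) volume ≤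
      (ENNReal.ofReal (sobolevConst n s lam) * energy K u) ^ ((1 : ℝ) / 2) := by
    refine (Lp.eLpNorm_lim_le_liminf_eLpNorm hmeas u (ae_of_all _ fun x => ?_)).trans ?_
    · refine tendsto_const_nhds.congr' ?_
      filter_upwards [Filter.eventually_ge_atTop ⌈|u x|⌉₊] with k hk
      exact (clip_of_abs_le (Nat.ceil_le.1 hk)).symm
    · refine Filter.liminf_le_of_le ?_ fun b hb => ?_
      · isBoundedDefault
      obtain ⟨k, hk⟩ := hb.exists
      refine hk.trans ?_
      rw [one_div, ENNReal.le_rpow_inv_iff two_pos]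
      refine le_trans ?_ ((sobolev_of_memLp hs0 hn hlam hK (hmem k)).trans ?_)
      · norm_num
      · exact mul_le_mul_right (energy_mono_of_abs_sub_le hK fun x y =>
          abs_clip_sub_clip_le _ _ _) _
  rw [one_div, ENNReal.le_rpow_inv_iff two_pos] at hlim
  simpa using hlim

end NonlocalSchrodinger

namespace NonlocalSchrodinger

/-! ### Soft thresholding -/

/-- Soft thresholding at level `c`, that is `sign t * max (|t| - c) 0` for `c ≥ 0`. -/
noncomputable def softThreshold (c t : ℝ) : ℝ := t - clip c t

lemma continuous_softThreshold (c : ℝ) : Continuous (softThreshold c) :=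
  continuous_id.sub (continuous_clip c)

lemma abs_softThreshold {c : ℝ} (hc : 0 ≤ c) (t : ℝ) : |softThreshold c t| = max (|t| - c) 0 := by
  unfold softThreshold clip; grind

lemma softThreshold_zero_left (t : ℝ) : softThreshold 0 t = t := by
  unfold softThreshold clip; grind

lemma abs_softThreshold_le {c : ℝ} (hc : 0 ≤ c) (t : ℝ) : |softThreshold c t| ≤ |t| := by
  rw [abs_softThreshold hc]
  exact max_le (by linarith) (abs_nonneg t)

lemma abs_softThreshold_anti {c d : ℝ} (hc : 0 ≤ c) (hcd : c ≤ d) (t : ℝ) :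
    |softThreshold d t| ≤ |softThreshold c t| := by
  rw [abs_softThreshold hc, abs_softThreshold (hc.trans hcd)]
  exact max_le_max (by linarith) le_rfl

lemma abs_softThreshold_sub_le (c a b : ℝ) :
    |softThreshold c a - softThreshold c b| ≤ |a - b| := by
  unfold softThreshold clip
  rcases le_total a b with h | h <;> grind

/-- Soft thresholding is nondecreasing and 1-Lipschitz. -/
lemma sq_softThreshold_sub_le (c a b : ℝ) :
    (softThreshold c a - softThreshold c b) ^ 2 ≤
      (a - b) * (softThreshold c a - softThreshold c b) := by
  have h := abs_softThreshold_sub_le c a b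
  have hsign : 0 ≤ (a - b) * (softThreshold c a - softThreshold c b) := by
    rcases le_total a b with hab | hab
    · refine mul_nonneg_of_nonpos_of_nonpos (by linarith) ?_
      unfold softThreshold clip; grind
    · refine mul_nonneg (by linarith) ?_
      unfold softThreshold clip; grind
  rw [← abs_of_nonneg hsign, abs_mul, ← sq_abs, sq]
  exact mul_le_mul_of_nonneg_right h (abs_nonneg _)

lemma mul_softThreshold_nonneg {c : ℝ} (hc : 0 ≤ c) (t : ℝ) : 0 ≤ t * softThreshold c t := by
  rcases le_total 0 t with h | h
  · refine mul_nonneg h ?_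
    unfold softThreshold clip; grind
  · refine mul_nonneg_of_nonpos_of_nonpos h ?_
    unfold softThreshold clip; grind

/-- If `|t| > d`, then `y = |t| - c ≥ d - c`, so `|t| = y + c ≤ d y / (d - c)`, and the factor `(y /
(d - c)) ^ θ ≥ 1` may be inserted for free. -/
lemma abs_mul_abs_softThreshold_le {c d θ : ℝ} (hc : 0 ≤ c) (hcd : c < d) (hθ : 0 ≤ θ) (t : ℝ) :
    |t| * |softThreshold d t| ≤
      d * (d - c) ^ (-(1 + θ)) * |softThreshold c t| ^ (2 + θ) := by
  have hd : 0 < d - c := sub_pos.2 hcd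
  rcases le_or_gt |t| d with ht | ht
  · have h0 : |softThreshold d t| = 0 := by
      rw [abs_softThreshold (hc.trans hcd.le)]
      exact max_eq_right (by linarith)
    rw [h0, mul_zero]
    have : 0 ≤ d := hc.trans hcd.le
    positivity
  · have hS : |softThreshold c t| = |t| - c := by
      rw [abs_softThreshold hc]
      exact max_eq_left (by linarith)
    set y := |softThreshold c t| with hy
    have hyd : d - c ≤ y := by linarith
    have hy0 : 0 < y := by linarith
    have h1 : |t| ≤ d * (d - c)⁻¹ * y := by
      rw [mul_right_comm, ← div_eq_mul_inv, le_div_iff₀ hd]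
      nlinarith
    have h2 : |softThreshold d t| ≤ y := abs_softThreshold_anti hc hcd.le t
    have h3 : 1 ≤ (d - c) ^ (-θ) * y ^ θ := by
      rw [Real.rpow_neg hd.le, ← Real.inv_rpow hd.le, ← Real.mul_rpow (by positivity) hy0.le]
      refine Real.one_le_rpow ?_ hθ
      rw [inv_mul_eq_div, one_le_div hd]
      exact hyd
    have hd0 : 0 < d := by linarith
    calc |t| * |softThreshold d t| ≤ d * (d - c)⁻¹ * y * y :=
          mul_le_mul h1 h2 (abs_nonneg _) (by positivity)
      _ ≤ d * (d - c)⁻¹ * y * y * ((d - c) ^ (-θ) * y ^ θ) :=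
          le_mul_of_one_le_right (by positivity) h3
      _ = d * (d - c) ^ (-(1 + θ)) * y ^ (2 + θ) := by
          rw [neg_add, Real.rpow_add hd, Real.rpow_neg_one, Real.rpow_add hy0, Real.rpow_two]
          ring

variable {n : ℕ} {s lam : ℝ} {K V b h : EuclideanSpace ℝ (Fin n) → ℝ}
  {g : EuclideanSpace ℝ (Fin n) → ℝ → ℝ} {v : EuclideanSpace ℝ (Fin n) → ℝ}

/-! ### Energy estimate for the truncated solution -/

lemma IsKernel.sub_sq_mul_eq (hK : IsKernel n s lam K) (u : EuclideanSpace ℝ (Fin n) → ℝ)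
    (w : EuclideanSpace ℝ (Fin n) → ℝ) (x y : EuclideanSpace ℝ (Fin n)) :
    ((u x - u y) * Real.sqrt (K (x - y))) * ((w x - w y) * Real.sqrt (K (x - y))) =
      (u x - u y) * (w x - w y) * K (x - y) := by
  -- The sign of `K 0` is unknown, but the differences vanish on the diagonal.
  rcases eq_or_ne x y with rfl | hxy
  · simp
  · rw [mul_mul_mul_comm, Real.mul_self_sqrt (hK.pos _ (sub_ne_zero.2 hxy)).le]

lemma MemX.integrable_form (hK : IsKernel n s lam K) {u w : EuclideanSpace ℝ (Fin n) → ℝ}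
    (hu : MemX K u) (hw : MemX K w) :
    Integrable (fun p : EuclideanSpace ℝ (Fin n) × EuclideanSpace ℝ (Fin n) =>
      (u p.1 - u p.2) * (w p.1 - w p.2) * K (p.1 - p.2)) (volume.prod volume) := by
  refine (hu.2.integrable_mul hw.2).congr (ae_of_all _ fun p => ?_)
  exact hK.sub_sq_mul_eq u w p.1 p.2

lemma IsKernel.sq_mul_nonneg (hK : IsKernel n s lam K) (u : EuclideanSpace ℝ (Fin n) → ℝ)
    (x y : EuclideanSpace ℝ (Fin n)) : 0 ≤ (u x - u y) * (u x - u y) * K (x - y) := by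
  rw [← hK.sub_sq_mul_eq]
  exact mul_self_nonneg _

lemma MemX.ofReal_form_self (hK : IsKernel n s lam K) {u : EuclideanSpace ℝ (Fin n) → ℝ}
    (hu : MemX K u) : energy K u = ENNReal.ofReal (form K u u) := by
  rw [form, ofReal_integral_eq_lintegral_ofReal (hu.integrable_form hK hu)
    (ae_of_all _ fun p => hK.sq_mul_nonneg u p.1 p.2), energy]
  simp only [sq]

lemma MemE.softThreshold (hK : IsKernel n s lam K) (hV : IsPotential n V) (hv : MemE K V v)
    {c : ℝ} (hc : 0 ≤ c) : MemE K V (fun x => softThreshold c (v x)) := by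
  have hm : AEStronglyMeasurable (fun x => NonlocalSchrodinger.softThreshold c (v x)) volume :=
    (continuous_softThreshold c).comp_aestronglyMeasurable hv.1.1.1
  refine ⟨⟨hv.1.1.mono hm (ae_of_all _ fun x => abs_softThreshold_le hc _), ?_⟩, ?_⟩
  · refine hv.1.2.mono ?_ (ae_of_all _ fun p => ?_)
    · have h1 : AEMeasurable (fun p : EuclideanSpace ℝ (Fin n) × EuclideanSpace ℝ (Fin n) =>
          K (p.1 - p.2)) (volume.prod volume) :=
        hK.aemeasurable.comp_quasiMeasurePreserving (quasiMeasurePreserving_sub volume volume)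
      exact ((hm.comp_fst.sub hm.comp_snd).aemeasurable.mul h1.sqrt).aestronglyMeasurable
    · rw [norm_mul, norm_mul]
      exact mul_le_mul_of_nonneg_right (abs_softThreshold_sub_le _ _ _) (norm_nonneg _)
  · refine hv.2.mono (hV.continuous.aestronglyMeasurable.mul (hm.pow 2))
      (ae_of_all _ fun x => ?_)
    rw [norm_mul, norm_mul]
    refine mul_le_mul_of_nonneg_left ?_ (norm_nonneg _)
    rw [norm_pow, norm_pow]
    exact pow_le_pow_left₀ (norm_nonneg _) (abs_softThreshold_le hc _) 2

lemma IsWeakSolution.energy_softThreshold_le (hK : IsKernel n s lam K) (hV : IsPotential n V)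
    (hb : ∀ x, 0 ≤ b x) (hg : ∀ᵐ x ∂volume, ∀ t : ℝ, |g x t| ≤ h x * |t|)
    (hv : IsWeakSolution K V b g v) {c : ℝ} (hc : 0 ≤ c) :
    energy K (fun x => softThreshold c (v x)) ≤
      ∫⁻ x, ‖h x‖ₑ * ENNReal.ofReal (|v x| * |softThreshold c (v x)|) := by
  have hS := hv.1.softThreshold hK hV hc
  obtain ⟨-, -, heq⟩ := hv.2 _ hS
  have h1 : form K (fun x => softThreshold c (v x)) (fun x => softThreshold c (v x)) ≤
      form K v (fun x => softThreshold c (v x)) := by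
    refine integral_mono (hS.1.integrable_form hK hS.1) (hv.1.1.integrable_form hK hS.1)
      fun p => ?_
    rcases eq_or_ne p.1 p.2 with hp | hp
    · simp [hp]
    · refine mul_le_mul_of_nonneg_right ?_ (hK.pos _ (sub_ne_zero.2 hp)).le
      rw [← sq]
      exact sq_softThreshold_sub_le _ _ _
  have h2 : 0 ≤ ∫ x, b x * v x * softThreshold c (v x) := by
    refine integral_nonneg fun x => ?_
    simp only [Pi.zero_apply]
    rw [mul_assoc]
    exact mul_nonneg (hb x) (mul_softThreshold_nonneg hc _)
  rw [hS.1.ofReal_form_self hK]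
  calc ENNReal.ofReal (form K (fun x => softThreshold c (v x)) fun x => softThreshold c (v x))
      ≤ ENNReal.ofReal |∫ x, g x (v x) * softThreshold c (v x)| :=
        ENNReal.ofReal_le_ofReal (le_trans (by linarith) (le_abs_self _))
    _ = ‖∫ x, g x (v x) * softThreshold c (v x)‖ₑ := (Real.enorm_eq_ofReal_abs _).symm
    _ ≤ ∫⁻ x, ‖g x (v x) * softThreshold c (v x)‖ₑ := enorm_integral_le_lintegral_enorm _
    _ ≤ _ := by
      refine lintegral_mono_ae ?_
      filter_upwards [hg] with x hx
      rw [Real.enorm_eq_ofReal_abs, Real.enorm_eq_ofReal_abs, ← ENNReal.ofReal_mul (abs_nonneg _),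
        abs_mul, ← mul_assoc]
      refine ENNReal.ofReal_le_ofReal (mul_le_mul_of_nonneg_right ?_ (abs_nonneg _))
      exact (hx _).trans (mul_le_mul_of_nonneg_right (le_abs_self _) (abs_nonneg _))

/-! ### One step of the iteration -/

/-- The gain of integrability when `h ∈ L^q` is paired with a power of a function in `L^p`, with
`p` the critical exponent. -/
noncomputable def gain (n : ℕ) (s : ℝ) (q : ℝ≥0∞) : ℝ := critExp n s * (1 - q⁻¹.toReal) - 2

/-- `1 / q < 2 s / n` and `p (1 - 2 s / n) = 2`. -/
lemma gain_pos (hs0 : 0 < s) (hn : 2 * s < (n : ℝ)) {q : ℝ≥0∞}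
    (hq : ENNReal.ofReal ((n : ℝ) / (2 * s)) < q) : 0 < gain n s q := by
  have hn0 : (0 : ℝ) < n := by linarith
  have h1 : q⁻¹.toReal < 2 * s / n := by
    have h := ENNReal.inv_lt_inv.2 hq
    rw [← ENNReal.ofReal_inv_of_pos (by positivity), inv_div] at h
    exact ENNReal.toReal_lt_of_lt_ofReal h
  have h2 := critExp_balance hs0 hn
  have h3 := mul_lt_mul_of_pos_left h1 (critExp_pos hs0 hn)
  unfold gain
  linarith

lemma lintegral_mul_rpow_le (hs0 : 0 < s) (hn : 2 * s < (n : ℝ)) {q : ℝ≥0∞}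
    (hq : ENNReal.ofReal ((n : ℝ) / (2 * s)) < q) (hh : AEStronglyMeasurable h volume)
    {w : EuclideanSpace ℝ (Fin n) → ℝ} (hw : AEStronglyMeasurable w volume) :
    ∫⁻ x, ‖h x‖ₑ * ENNReal.ofReal (|w x| ^ (2 + gain n s q)) ≤
      eLpNorm h q volume *
        eLpNorm w (ENNReal.ofReal (critExp n s)) volume ^ (2 + gain n s q) := by
  have hθ := gain_pos hs0 hn hq
  have hq1 : 1 ≤ q := by
    refine le_trans ?_ hq.le
    rw [ENNReal.one_le_ofReal, one_le_div (by positivity)]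
    exact hn.le
  have : q.HolderConjugate q.conjExponent := ENNReal.HolderConjugate.conjExponent hq1
  have hsum : q⁻¹ + q.conjExponent⁻¹ = 1 := ENNReal.HolderConjugate.inv_add_inv_eq_one q _
  have hqi : q⁻¹ ≠ ∞ := ne_top_of_le_ne_top ENNReal.one_ne_top (hsum ▸ le_self_add)
  have hqc : q.conjExponent⁻¹ ≠ ∞ := ne_top_of_le_ne_top ENNReal.one_ne_top (hsum ▸ le_add_self)
  have hreal : q.conjExponent⁻¹.toReal = 1 - q⁻¹.toReal := by
    have := congrArg ENNReal.toReal hsum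
    rw [ENNReal.toReal_add hqi hqc, ENNReal.toReal_one] at this
    linarith
  have hpos : 0 < 2 + gain n s q := by linarith
  have hgain : 2 + gain n s q = critExp n s * q.conjExponent⁻¹.toReal := by
    rw [hreal, gain]; ring
  have hne0 : q.conjExponent⁻¹ ≠ 0 := by
    intro h0
    rw [hgain, h0] at hpos
    simp at hpos
  have hexp : q.conjExponent * ENNReal.ofReal (2 + gain n s q) =
      ENNReal.ofReal (critExp n s) := by
    rw [hgain, ENNReal.ofReal_mul (critExp_pos hs0 hn).le, ENNReal.ofReal_toReal hqc,
      mul_left_comm, ENNReal.mul_inv_cancel, mul_one]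
    · exact fun h0 => hqc (by simp [h0])
    · exact fun h0 => hne0 (by simp [h0])
  have hwp : AEStronglyMeasurable (fun x => ‖w x‖ ^ (2 + gain n s q)) volume :=
    (hw.norm.aemeasurable.pow_const _).aestronglyMeasurable
  have hH := eLpNorm_smul_le_mul_eLpNorm (p := q) (q := q.conjExponent) (r := 1) hwp hh
  rw [eLpNorm_norm_rpow w hpos, hexp, eLpNorm_one_eq_lintegral_enorm] at hH
  refine le_trans (lintegral_mono fun x => ?_) hH
  rw [Pi.smul_apply', enorm_smul, ← Real.norm_eq_abs,
    Real.enorm_of_nonneg (Real.rpow_nonneg (norm_nonneg (w x)) _)]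

lemma IsWeakSolution.eLpNorm_softThreshold_step (hs0 : 0 < s) (hn : 2 * s < (n : ℝ))
    (hlam : 0 < lam) (hK : IsKernel n s lam K) (hV : IsPotential n V)
    (hb : ∀ x, 0 ≤ b x) {q : ℝ≥0∞} (hq : ENNReal.ofReal ((n : ℝ) / (2 * s)) < q)
    (hh : AEStronglyMeasurable h volume)
    (hg : ∀ᵐ x ∂volume, ∀ t : ℝ, |g x t| ≤ h x * |t|)
    (hv : IsWeakSolution K V b g v) {c d : ℝ} (hc : 0 ≤ c) (hcd : c < d) :
    eLpNorm (fun x => softThreshold d (v x)) (ENNReal.ofReal (critExp n s)) volume ^ 2 ≤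
      ENNReal.ofReal (sobolevConst n s lam) *
        (ENNReal.ofReal (d * (d - c) ^ (-(1 + gain n s q))) * (eLpNorm h q volume *
          eLpNorm (fun x => softThreshold c (v x)) (ENNReal.ofReal (critExp n s)) volume ^
            (2 + gain n s q))) := by
  have hd : 0 ≤ d := hc.trans hcd.le
  have hdc : 0 ≤ d - c := sub_nonneg.2 hcd.le
  have hSd := hv.1.softThreshold hK hV hd
  have hSc := hv.1.softThreshold hK hV hc
  refine (sobolev hs0 hn hlam hK hSd.1.1).trans (mul_le_mul_right ?_ _)
  refine (hv.energy_softThreshold_le hK hV hb hg hd).trans ?_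
  refine le_trans ?_ (mul_le_mul_right (lintegral_mul_rpow_le hs0 hn hq hh hSc.1.1.1) _)
  rw [← lintegral_const_mul' _ _ ENNReal.ofReal_ne_top]
  refine lintegral_mono fun x => ?_
  rw [mul_left_comm, ← ENNReal.ofReal_mul (by positivity)]
  exact mul_le_mul_right (ENNReal.ofReal_le_ofReal
    (abs_mul_abs_softThreshold_le hc hcd (gain_pos hs0 hn hq).le _)) _

/-! ### De Giorgi iteration -/

/-- Geometric decay for the nonlinear recursion of De Giorgi's method. -/
lemma exists_geometric_decay {θ B : ℝ} (hθ : 0 < θ) (hB : 0 ≤ B) :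
    ∃ δ ρ : ℝ, 0 < δ ∧ 0 < ρ ∧ ρ < 1 ∧ ∀ A : ℝ, 0 < A → ∀ k : ℕ,
      B * (A * (A / 2 ^ (k + 1)) ^ (-(1 + θ))) * (A * δ * ρ ^ k) ^ (2 + θ) ≤
        (A * δ * ρ ^ (k + 1)) ^ 2 := by
  set D : ℝ := 2 ^ (1 + θ) with hD
  have hD0 : 0 < D := by positivity
  -- Chosen so that `ρ ^ (k θ)` cancels the growth `D ^ (k + 1)` caused by the shrinking gaps, up to
  -- one factor `D`.
  set ρ : ℝ := D⁻¹ ^ θ⁻¹ with hρ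
  have hρ0 : 0 < ρ := by positivity
  have hρθ : ρ ^ θ = D⁻¹ := by
    rw [hρ, ← Real.rpow_mul (by positivity), inv_mul_cancel₀ hθ.ne', Real.rpow_one]
  have hρ1 : ρ < 1 := by
    refine Real.rpow_lt_one (by positivity) ?_ (by positivity)
    exact inv_lt_one_of_one_lt₀ (Real.one_lt_rpow one_lt_two (by linarith))
  -- Makes `B D δ ^ θ ≤ ρ ^ 2`; the `+ 1` keeps the denominator positive when `B = 0`.
  set δ : ℝ := (ρ ^ 2 / (B * D + 1)) ^ θ⁻¹ with hδ
  have hδ0 : 0 < δ := by positivity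
  have hδθ : B * D * δ ^ θ ≤ ρ ^ 2 := by
    rw [hδ, ← Real.rpow_mul (by positivity), inv_mul_cancel₀ hθ.ne', Real.rpow_one, ← mul_div_assoc,
      div_le_iff₀ (by positivity)]
    nlinarith [sq_nonneg ρ]
  refine ⟨δ, ρ, hδ0, hρ0, hρ1, fun A hA k => ?_⟩
  have h1 : A * (A / 2 ^ (k + 1)) ^ (-(1 + θ)) = A ^ (-θ) * D ^ (k + 1) := by
    rw [Real.rpow_neg (by positivity), ← Real.inv_rpow (by positivity), inv_div,
      Real.div_rpow (by positivity) hA.le, ← Real.rpow_natCast 2 (k + 1), ← Real.rpow_mul two_pos.le,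
      mul_comm ((k + 1 : ℕ) : ℝ), Real.rpow_mul two_pos.le, Real.rpow_natCast, ← hD,
      Real.rpow_add hA, Real.rpow_one, Real.rpow_neg hA.le]
    field_simp
  have h2 : (A * δ * ρ ^ k) ^ (2 + θ) = (A * δ * ρ ^ k) ^ 2 * (A ^ θ * δ ^ θ * (D⁻¹) ^ k) := by
    rw [Real.rpow_add (by positivity), Real.rpow_two, Real.mul_rpow (by positivity) (by positivity),
      Real.mul_rpow hA.le hδ0.le, ← hρθ, ← Real.rpow_natCast ρ k, ← Real.rpow_mul hρ0.le,
      mul_comm (k : ℝ), Real.rpow_mul hρ0.le, Real.rpow_natCast, Real.rpow_natCast]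
  have h3 : A ^ (-θ) * A ^ θ = 1 := by
    rw [← Real.rpow_add hA, neg_add_cancel, Real.rpow_zero]
  have h4 : D ^ (k + 1) * D⁻¹ ^ k = D := by
    rw [pow_succ', mul_assoc, ← mul_pow, mul_inv_cancel₀ hD0.ne', one_pow, mul_one]
  rw [h1, h2]
  calc B * (A ^ (-θ) * D ^ (k + 1)) * ((A * δ * ρ ^ k) ^ 2 * (A ^ θ * δ ^ θ * D⁻¹ ^ k))
      = (A ^ (-θ) * A ^ θ) * (B * (D ^ (k + 1) * D⁻¹ ^ k) * δ ^ θ) * (A * δ * ρ ^ k) ^ 2 := by ring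
    _ = (B * D * δ ^ θ) * (A * δ * ρ ^ k) ^ 2 := by rw [h3, h4, one_mul]
    _ ≤ ρ ^ 2 * (A * δ * ρ ^ k) ^ 2 := mul_le_mul_of_nonneg_right hδθ (sq_nonneg _)
    _ = (A * δ * ρ ^ (k + 1)) ^ 2 := by ring

lemma IsWeakSolution.eLpNorm_softThreshold_le (hs0 : 0 < s) (hn : 2 * s < (n : ℝ))
    (hlam : 0 < lam) (hK : IsKernel n s lam K) (hV : IsPotential n V)
    (hb : ∀ x, 0 ≤ b x) {q : ℝ≥0∞} (hq : ENNReal.ofReal ((n : ℝ) / (2 * s)) < q)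
    (hh : MemLp h q volume) (hg : ∀ᵐ x ∂volume, ∀ t : ℝ, |g x t| ≤ h x * |t|)
    (hv : IsWeakSolution K V b g v) {δ ρ A : ℝ} (hδ : 0 < δ) (hρ : 0 < ρ) (hA : 0 < A)
    (hdecay : ∀ k : ℕ, sobolevConst n s lam * (eLpNorm h q volume).toReal *
      (A * (A / 2 ^ (k + 1)) ^ (-(1 + gain n s q))) * (A * δ * ρ ^ k) ^ (2 + gain n s q) ≤
        (A * δ * ρ ^ (k + 1)) ^ 2)
    (hinit : eLpNorm v (ENNReal.ofReal (critExp n s)) volume ≤ ENNReal.ofReal (A * δ)) (k : ℕ) :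
    eLpNorm (fun x => softThreshold (A * (1 - 1 / 2 ^ k)) (v x))
      (ENNReal.ofReal (critExp n s)) volume ≤ ENNReal.ofReal (A * δ * ρ ^ k) := by
  induction k with
  -- The first level is 0, where thresholding is the identity.
  | zero => simpa [softThreshold_zero_left] using hinit
  | succ k ih =>
    have hθ := gain_pos hs0 hn hq
    have hC := sobolevConst_pos n s hlam
    have hk : (1 : ℝ) / 2 ^ k ≤ 1 := by
      rw [div_le_one (by positivity)]; exact one_le_pow₀ one_le_two
    have hsub : A * (1 - 1 / 2 ^ (k + 1)) - A * (1 - 1 / 2 ^ k) = A / 2 ^ (k + 1) := by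
      rw [pow_succ]; field_simp; ring
    have hpos : 0 < A / 2 ^ (k + 1) := by positivity
    have hstep := hv.eLpNorm_softThreshold_step hs0 hn hlam hK hV hb hq hh.1 hg
      (c := A * (1 - 1 / 2 ^ k)) (d := A * (1 - 1 / 2 ^ (k + 1)))
      (mul_nonneg hA.le (by linarith)) (by linarith)
    rw [hsub] at hstep
    have hdA : A * (1 - 1 / 2 ^ (k + 1)) ≤ A :=
      mul_le_of_le_one_right hA.le (sub_le_self _ (by positivity))
    refine (ENNReal.pow_le_pow_left_iff two_ne_zero).1 (hstep.trans ?_)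
    rw [← ENNReal.ofReal_pow (by positivity)]
    refine le_trans ?_ (ENNReal.ofReal_le_ofReal (hdecay k))
    have hcoef : A * (1 - 1 / 2 ^ (k + 1)) * (A / 2 ^ (k + 1)) ^ (-(1 + gain n s q)) ≤
        A * (A / 2 ^ (k + 1)) ^ (-(1 + gain n s q)) :=
      mul_le_mul_of_nonneg_right hdA (by positivity)
    have hcoef0 : 0 ≤ A * (A / 2 ^ (k + 1)) ^ (-(1 + gain n s q)) := by positivity
    generalize A * (A / 2 ^ (k + 1)) ^ (-(1 + gain n s q)) = a at hcoef hcoef0 ⊢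
    rw [mul_assoc (sobolevConst n s lam * _), mul_assoc (sobolevConst n s lam),
      ENNReal.ofReal_mul hC.le, ENNReal.ofReal_mul ENNReal.toReal_nonneg,
      ENNReal.ofReal_toReal hh.2.ne, ENNReal.ofReal_mul hcoef0,
      ← ENNReal.ofReal_rpow_of_pos (by positivity), mul_left_comm (eLpNorm h q volume)]
    exact mul_le_mul_right (mul_le_mul' (ENNReal.ofReal_le_ofReal hcoef)
      (mul_le_mul_right (ENNReal.rpow_le_rpow ih (by linarith)) _)) _

/-- All levels lie below `A`, so `|S_A v|` is dominated by every iterate; its norm is therefore 0.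
-/
lemma IsWeakSolution.eLpNorm_top_le (hs0 : 0 < s) (hn : 2 * s < (n : ℝ))
    (hlam : 0 < lam) (hK : IsKernel n s lam K) (hV : IsPotential n V)
    (hb : ∀ x, 0 ≤ b x) {q : ℝ≥0∞} (hq : ENNReal.ofReal ((n : ℝ) / (2 * s)) < q)
    (hh : MemLp h q volume) (hg : ∀ᵐ x ∂volume, ∀ t : ℝ, |g x t| ≤ h x * |t|)
    (hv : IsWeakSolution K V b g v) {δ ρ A : ℝ} (hδ : 0 < δ) (hρ : 0 < ρ) (hρ1 : ρ < 1)
    (hA : 0 < A)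
    (hdecay : ∀ k : ℕ, sobolevConst n s lam * (eLpNorm h q volume).toReal *
      (A * (A / 2 ^ (k + 1)) ^ (-(1 + gain n s q))) * (A * δ * ρ ^ k) ^ (2 + gain n s q) ≤
        (A * δ * ρ ^ (k + 1)) ^ 2)
    (hinit : eLpNorm v (ENNReal.ofReal (critExp n s)) volume ≤ ENNReal.ofReal (A * δ)) :
    eLpNorm v ∞ volume ≤ ENNReal.ofReal A := by
  have hbound : ∀ k : ℕ, eLpNorm (fun x => softThreshold A (v x))
      (ENNReal.ofReal (critExp n s)) volume ≤ ENNReal.ofReal (A * δ * ρ ^ k) := by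
    intro k
    refine le_trans (eLpNorm_mono fun x => abs_softThreshold_anti ?_ ?_ _)
      (hv.eLpNorm_softThreshold_le hs0 hn hlam hK hV hb hq hh hg hδ hρ hA hdecay hinit k)
    · refine mul_nonneg hA.le (sub_nonneg.2 ?_)
      rw [div_le_one (by positivity)]; exact one_le_pow₀ one_le_two
    · exact mul_le_of_le_one_right hA.le (sub_le_self _ (by positivity))
  have hlim : Filter.Tendsto (fun k : ℕ => ENNReal.ofReal (A * δ * ρ ^ k)) Filter.atTop
      (nhds 0) := by
    rw [← ENNReal.ofReal_zero, ← mul_zero (A * δ)]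
    exact ENNReal.tendsto_ofReal
      ((tendsto_pow_atTop_nhds_zero_of_lt_one hρ.le hρ1).const_mul _)
  have hzero : eLpNorm (fun x => softThreshold A (v x))
      (ENNReal.ofReal (critExp n s)) volume = 0 :=
    le_antisymm (ge_of_tendsto' hlim hbound) zero_le
  rw [eLpNorm_eq_zero_iff ((continuous_softThreshold A).comp_aestronglyMeasurable hv.1.1.1.1)
    (by simpa using critExp_pos hs0 hn)] at hzero
  rw [eLpNorm_exponent_top]
  refine eLpNormEssSup_le_of_ae_bound ?_
  filter_upwards [hzero] with x hx
  have habs := abs_softThreshold hA.le (v x)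
  rw [Pi.zero_apply] at hx
  rw [hx, abs_zero] at habs
  have := le_max_left (|v x| - A) 0
  rw [Real.norm_eq_abs]
  linarith

lemma MemE.eLpNorm_critExp_lt_top (hs0 : 0 < s) (hn : 2 * s < (n : ℝ)) (hlam : 0 < lam)
    (hK : IsKernel n s lam K) (hv : MemE K V v) :
    eLpNorm v (ENNReal.ofReal (critExp n s)) volume < ∞ := by
  have h := sobolev hs0 hn hlam hK hv.1.1
  rw [hv.1.ofReal_form_self hK] at h
  have h2 := h.trans_lt (ENNReal.mul_lt_top ENNReal.ofReal_lt_top ENNReal.ofReal_lt_top)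
  exact (ENNReal.pow_lt_top_iff.1 h2).resolve_right two_ne_zero

end NonlocalSchrodinger

/-- The bound `M` depends on `q` and `‖h‖_q` only, once `n`, `s` and the ellipticity constant
`lam` of the kernel are fixed; it does not depend on `K`, `V`, `b`, `g`, `h` or `v` otherwise. -/
theorem proposition4p5 (n : ℕ) (s lam : ℝ) (hs0 : 0 < s) (hs1 : s < 1) (hn : 2 * s < (n : ℝ))
    (hlam : 0 < lam) :
    ∃ M : ℝ≥0∞ → ℝ → ℝ≥0,
      ∀ (K V b h : EuclideanSpace ℝ (Fin n) → ℝ) (g : EuclideanSpace ℝ (Fin n) → ℝ → ℝ)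
        (v : EuclideanSpace ℝ (Fin n) → ℝ) (q : ℝ≥0∞),
        NonlocalSchrodinger.IsKernel n s lam K →
        NonlocalSchrodinger.IsPotential n V →
        (∀ x, 0 ≤ b x) →
        ENNReal.ofReal ((n : ℝ) / (2 * s)) < q →
        MemLp h q volume →
        (∀ᵐ x ∂volume, ∀ t : ℝ, |g x t| ≤ h x * |t|) →
        NonlocalSchrodinger.IsWeakSolution K V b g v →
        MemLp v ⊤ volume ∧
          eLpNorm v ⊤ volume ≤ (M q (eLpNorm h q volume).toReal : ℝ≥0∞) *
            eLpNorm v (ENNReal.ofReal (NonlocalSchrodinger.critExp n s)) volume := by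
  open NonlocalSchrodinger in
  have hdecay : ∀ (q : ℝ≥0∞) (t : ℝ), ∃ δ : ℝ, 0 < δ ∧
      (ENNReal.ofReal ((n : ℝ) / (2 * s)) < q → 0 ≤ t → ∃ ρ : ℝ, 0 < ρ ∧ ρ < 1 ∧
        ∀ A : ℝ, 0 < A → ∀ k : ℕ, sobolevConst n s lam * t *
          (A * (A / 2 ^ (k + 1)) ^ (-(1 + gain n s q))) *
            (A * δ * ρ ^ k) ^ (2 + gain n s q) ≤ (A * δ * ρ ^ (k + 1)) ^ 2) := by
    intro q t
    by_cases hqt : ENNReal.ofReal ((n : ℝ) / (2 * s)) < q ∧ 0 ≤ t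
    · obtain ⟨δ, ρ, hδ, hρ, hρ1, hd⟩ := exists_geometric_decay (gain_pos hs0 hn hqt.1)
        (mul_nonneg (sobolevConst_pos n s hlam).le hqt.2)
      exact ⟨δ, hδ, fun _ _ => ⟨ρ, hρ, hρ1, hd⟩⟩
    -- Default value outside the relevant range, so that `δ` is a function of all `(q, t)`.
    · exact ⟨1, one_pos, fun h1 h2 => absurd ⟨h1, h2⟩ hqt⟩
  choose δ hδ hdecay using hdecay
  refine ⟨fun q t => (δ q t)⁻¹.toNNReal, fun K V b h g v q hK hV hb hq hh hg hv => ?_⟩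
  set t := (eLpNorm h q volume).toReal
  set P := ENNReal.ofReal (NonlocalSchrodinger.critExp n s)
  have hfin : eLpNorm v P volume < ⊤ := hv.1.eLpNorm_critExp_lt_top hs0 hn hlam hK
  obtain ⟨ρ, hρ, hρ1, hd⟩ := hdecay q t hq ENNReal.toReal_nonneg
  have hδ0 := hδ q t
  have hle : eLpNorm v ⊤ volume ≤
      ((δ q t)⁻¹.toNNReal : ℝ≥0∞) * eLpNorm v P volume := by
    -- The added `ε` keeps `A` positive even when `‖v‖_p = 0`.
    refine ENNReal.le_of_forall_pos_le_add fun ε hε _ => ?_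
    set N := (eLpNorm v P volume).toReal with hN
    have hN0 : 0 ≤ N := ENNReal.toReal_nonneg
    have hA : 0 < (δ q t)⁻¹ * N + ε := by positivity
    have hinit : eLpNorm v P volume ≤ ENNReal.ofReal (((δ q t)⁻¹ * N + ε) * δ q t) := by
      rw [← ENNReal.ofReal_toReal hfin.ne, ← hN]
      refine ENNReal.ofReal_le_ofReal ?_
      have : ((δ q t)⁻¹ * N + ε) * δ q t = N + ε * δ q t := by field_simp
      rw [this]
      exact le_add_of_nonneg_right (by positivity)
    refine (hv.eLpNorm_top_le hs0 hn hlam hK hV hb hq hh hg hδ0 hρ hρ1 hA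
      (hd _ hA) hinit).trans_eq ?_
    rw [ENNReal.ofReal_add (by positivity) (by positivity), ENNReal.ofReal_mul (by positivity),
      hN, ENNReal.ofReal_toReal hfin.ne, ENNReal.ofReal_coe_nnreal, ENNReal.ofReal]
  exact ⟨⟨hv.1.1.1.1, hle.trans_lt (ENNReal.mul_lt_top ENNReal.coe_lt_top hfin)⟩, hle⟩
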